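/- For topological spaces $X,Y$ let $C_k(X,Y)$ be the space of continuous maps $X\to Y$ with the compact-open topology. A class of topological spaces is *$C_k$-stable* if it is closed under taking subspaces, homeomorphic images, countable topological sums, countable Tychonoff products (finite and empty sums and products included), and if it contains $C_k(X,Y)$ for every Lindelöf space $X$ and every space $Y$ in the class. For a class $\mathcal X$ of topological spaces let $C_k[\mathcal X]$ denote the smallest $C_k$-stable class containing $\mathcal X$, and let $\mathcal M_0$ be the class of all separable metrizable spaces. An *$\aleph_0$-space* is a regular $T_1$-space $X$ with a countable $k$-network, that is, a countable family $\mathcal N$ of subsets of $X$ such that for every open $U\subseteq X$ and every compact $K\subseteq U$ there is a finite $\mathcal F\subseteq\mathcal N$ with $K\subseteq\bigcup\mathcal F\subseteq U$. A space $X$ is *$Y$-Ascoli* if every compact set $\mathcal K\subseteq C_k(X,Y)$ is evenly continuous, i.e. the evaluation map $\mathcal K\times X\to Y$, $(f,x)\mapsto f(x)$, is continuous; $X$ is *Ascoli* if it is $\mathbb R$-Ascoli, and *$2$-Ascoli* if it is $\{0,1\}$-Ascoli for the discrete doubleton $\{0,1\}$. A space is *zero-dimensional* if its clopen sets form a base of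 its topology. **Theorem.** Let $\mathcal X$ be a non-empty class of topological spaces. 1. $C_k[\mathcal X]$ contains every zero-dimensional $2$-Ascoli $\aleph_0$-space. 2. If $\mathcal X$ contains (a homeomorphic copy of) the interval $[0,1]$, then $C_k[\mathcal X]$ contains every Ascoli $\aleph_0$-space. In particular, every Ascoli $\aleph_0$-space belongs to $C_k[\mathcal M_0]$. -/

import Mathlib

open Set TopologicalSpace

universe u v

namespace AscoliCk

/-- A class of topological spaces (spaces whose points form a type in a fixed universe). -/
abbrev SpaceClass := Set TopCat.{u}

/-- A class of spaces is stable if it is closed under subspaces, homeomorphic images, countable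
topological sums and countable Tychonoff products.  Countable index sets may be finite or empty. -/
structure IsStable (P : SpaceClass.{u}) : Prop where
  subspace : ∀ X ∈ P, ∀ s : Set X, TopCat.of s ∈ P
  homeo : ∀ X ∈ P, ∀ Y : TopCat.{u}, Nonempty (X ≃ₜ Y) → Y ∈ P
  sum : ∀ (ι : Type) [Countable ι] (X : ι → TopCat.{u}), (∀ i, X i ∈ P) →
    TopCat.of (Σ i, X i) ∈ P
  prod : ∀ (ι : Type) [Countable ι] (X : ι → TopCat.{u}), (∀ i, X i ∈ P) →
    TopCat.of (∀ i, X i) ∈ P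

/-- A class of spaces is `C_k`-stable if it is stable and contains `C_k(X, Y)` (continuous maps
with the compact-open topology) for every Lindelöf `X` and every `Y` in the class. -/
structure IsCkStable (P : SpaceClass.{u}) : Prop extends IsStable P where
  funSpace : ∀ X ∈ P, LindelofSpace X → ∀ Y ∈ P, TopCat.of C(X, Y) ∈ P

/-- The `C_k`-stable closure of a class: the smallest `C_k`-stable class containing it. -/
def ckClosure (P : SpaceClass.{u}) : SpaceClass.{u} :=
  ⋂₀ {Q | IsCkStable Q ∧ P ⊆ Q}

/-- `ckClosure P` is indeed the smallest `C_k`-stable class containing `P`. -/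
theorem isLeast_ckClosure (P : SpaceClass.{u}) :
    IsLeast {Q : SpaceClass.{u} | IsCkStable Q ∧ P ⊆ Q} (ckClosure P) := by
  refine ⟨⟨⟨⟨?_, ?_, ?_, ?_⟩, ?_⟩, ?_⟩, fun Q hQ => sInter_subset_of_mem hQ⟩
  · exact fun X hX s Q hQ => hQ.1.subspace X (hX Q hQ) s
  · exact fun X hX Y h Q hQ => hQ.1.homeo X (hX Q hQ) Y h
  · exact fun ι _ X hX Q hQ => hQ.1.sum ι X fun i => hX i Q hQ
  · exact fun ι _ X hX Q hQ => hQ.1.prod ι X fun i => hX i Q hQ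
  · exact fun X hX hL Y hY Q hQ => hQ.1.funSpace X (hX Q hQ) hL Y (hY Q hQ)
  · exact subset_sInter fun Q hQ => hQ.2

/-- The class of all separable metrizable spaces. -/
def separableMetrizable : SpaceClass.{u} :=
  {X | MetrizableSpace X ∧ SeparableSpace X}

/-- A family `N` of subsets of `X` is a `k`-network if, for all `K ⊆ U` with `K` compact and `U`
open, finitely many members of `N` have a union between `K` and `U`. -/
def IsKNetwork {X : Type u} [TopologicalSpace X] (N : Set (Set X)) : Prop :=
  ∀ U K : Set X, IsOpen U → IsCompact K → K ⊆ U →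
    ∃ F : Set (Set X), F ⊆ N ∧ F.Finite ∧ K ⊆ ⋃₀ F ∧ ⋃₀ F ⊆ U

/-- An `ℵ₀`-space: a regular `T₁`-space with a countable `k`-network. -/
def IsAlephZeroSpace (X : Type u) [TopologicalSpace X] : Prop :=
  T3Space X ∧ ∃ N : Set (Set X), N.Countable ∧ IsKNetwork N

/-- A set `K` of continuous maps (with the subspace topology from the compact-open topology) is
evenly continuous if evaluation `K × X → Y` is continuous. -/
def IsEvenlyContinuous {X : Type u} {Y : Type v} [TopologicalSpace X] [TopologicalSpace Y]
    (K : Set C(X, Y)) : Prop :=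
  Continuous fun p : K × X => (p.1 : C(X, Y)) p.2

/-- `X` is `Y`-Ascoli if every compact subset of `C_k(X, Y)` is evenly continuous. -/
def IsAscoliFor (X : Type u) (Y : Type v) [TopologicalSpace X] [TopologicalSpace Y] : Prop :=
  ∀ K : Set C(X, Y), IsCompact K → IsEvenlyContinuous K

/-- An Ascoli space is an `ℝ`-Ascoli space. -/
def IsAscoli (X : Type u) [TopologicalSpace X] : Prop := IsAscoliFor X ℝ

/-- A `2`-Ascoli space, where `2` is the discrete doubleton, here `Bool`. -/
def IsTwoAscoli (X : Type u) [TopologicalSpace X] : Prop := IsAscoliFor X Bool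

/-- Zero-dimensional: the clopen sets form a base of the topology. -/
def IsZeroDimensional (X : Type u) [TopologicalSpace X] : Prop :=
  IsTopologicalBasis {s : Set X | IsClopen s}

end AscoliCk

/-! Let `Y` be the doubleton or the interval. Evaluation sends `X` into `C_k(C_k(X, Y), Y)`. Being
`Y`-Ascoli makes this map continuous, and enough maps into `Y` make it an embedding. It remains to
see that `C_k(X, Y)` is Lindelöf and lies in the class. An `ℵ₀`-space is a compact-covering image of
some `S ⊆ ℕ → ℕ` (`IsAlephZeroSpace.exists_compactCovering`), so `C_k(X, Y)` embeds in `C_k(S, Y)`,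
which is hereditarily Lindelöf (`isLindelof_continuousMap`). Every stable class contains `S`: the
empty product is a point, sums of points give `ℕ`, and products and subspaces give `S`. -/

namespace AscoliCk

open Topology

/-! ### Closed `k`-networks and compact-covering maps -/

section KNetwork

variable {X : Type u} [TopologicalSpace X]

/-- An `ℵ₀`-space has a `k`-network of closed sets indexed by the natural numbers. -/
theorem IsAlephZeroSpace.exists_closed_seq (h : IsAlephZeroSpace X) :
    ∃ e : ℕ → Set X, (∀ n, IsClosed (e n)) ∧
      ∀ U K : Set X, IsOpen U → IsCompact K → K ⊆ U →
        ∃ F : Finset ℕ, K ⊆ ⋃ i ∈ F, e i ∧ ∀ i ∈ F, e i ⊆ U := by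
  obtain ⟨hX, N, hNc, hN⟩ := h
  obtain ⟨d, hd⟩ := (hNc.insert ∅).exists_eq_range (insert_nonempty _ _)
  refine ⟨fun n => closure (d n), fun n => isClosed_closure, fun U K hU hK hKU => ?_⟩
  obtain ⟨V, hV, hKV, hVU⟩ := hK.exists_isOpen_closure_subset (hU.mem_nhdsSet.2 hKU)
  obtain ⟨F, hFN, hF, hKF, hFV⟩ := hN V K hV hK hKV
  have hFd : ∀ A ∈ F, ∃ n, d n = A := fun A hA => by
    have : A ∈ range d := hd ▸ mem_insert_of_mem _ (hFN hA)
    exact this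
  choose! g hg using hFd
  refine ⟨hF.toFinset.image g, fun x hx => ?_, fun i hi => ?_⟩
  · obtain ⟨A, hA, hxA⟩ := hKF hx
    refine mem_iUnion₂.2 ⟨g A, Finset.mem_image_of_mem g (hF.mem_toFinset.2 hA), ?_⟩
    exact subset_closure (by rwa [hg A hA])
  · obtain ⟨A, hA, rfl⟩ := Finset.mem_image.1 hi
    rw [hF.mem_toFinset] at hA
    refine (closure_mono ?_).trans hVU
    rw [hg A hA]
    exact (subset_sUnion_of_mem hA).trans hFV

/-- Every `ℵ₀`-space is a compact-covering image of a subspace of the Baire space. -/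
theorem IsAlephZeroSpace.exists_compactCovering (h : IsAlephZeroSpace X) :
    ∃ (S : Set (ℕ → ℕ)) (p : C(S, X)), ∀ K : Set X, IsCompact K →
      ∃ L : Set S, IsCompact L ∧ p '' L = K := by
  obtain ⟨e, hec, he⟩ := h.exists_closed_seq
  have := h.1
  -- A sequence `s` codes `x` when the sets `e (s i)` form a network at `x`; `q` decodes.
  let R : (ℕ → ℕ) → X → Prop := fun s x =>
    (∀ i, x ∈ e (s i)) ∧ ∀ U, IsOpen U → x ∈ U → ∃ i, e (s i) ⊆ U
  have huniq : ∀ s x y, R s x → (∀ i, y ∈ e (s i)) → y = x := by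
    intro s x y hx hy
    by_contra hne
    obtain ⟨i, hi⟩ := hx.2 {y}ᶜ isOpen_compl_singleton (fun h => hne (Eq.symm h))
    exact hi (hy i) rfl
  choose q hq using fun s : {s | ∃ x, R s x} => s.2
  have hqc : Continuous q := by
    refine continuous_def.2 fun U hU => isOpen_iff_forall_mem_open.2 fun s hs => ?_
    obtain ⟨i, hi⟩ := (hq s).2 U hU hs
    refine ⟨{t | t.1 i = s.1 i}, fun t ht => hi ?_, ?_, rfl⟩
    · have := (hq t).1 i
      rwa [show t.1 i = s.1 i from ht] at this
    · have hci : Continuous fun t : {s | ∃ x, R s x} => t.1 i :=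
        (continuous_apply i).comp continuous_subtype_val
      exact (isOpen_discrete ({s.1 i} : Set ℕ)).preimage hci
  refine ⟨_, ⟨q, hqc⟩, fun K hK => ?_⟩
  obtain ⟨F₀, hF₀, -⟩ := he univ K isOpen_univ hK (subset_univ _)
  -- `c` lists all finite covers of `K` from the network. Choosing one member from each keeps the
  -- codes in a compact product of finite sets.
  obtain ⟨c, hc⟩ := (to_countable {F : Finset ℕ | K ⊆ ⋃ i ∈ F, e i}).exists_eq_range ⟨F₀, hF₀⟩
  have hcK : ∀ j, K ⊆ ⋃ i ∈ c j, e i := fun j => by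
    have : c j ∈ {F : Finset ℕ | K ⊆ ⋃ i ∈ F, e i} := hc ▸ mem_range_self j
    exact this
  have hR : ∀ s x, x ∈ K → (∀ i, s i ∈ c i) → (∀ i, x ∈ e (s i)) → R s x := by
    refine fun s x hx hs hxs => ⟨hxs, fun U hU hxU => ?_⟩
    obtain ⟨V, hV, hxV, hVU⟩ := isCompact_singleton.exists_isOpen_closure_subset
      (hU.mem_nhdsSet.2 (singleton_subset_iff.2 hxU))
    obtain ⟨F, hF, hFU⟩ := he U (K ∩ closure V) hU (hK.inter_right isClosed_closure)
      (inter_subset_right.trans hVU)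
    obtain ⟨G, hG, hGx⟩ := he {x}ᶜ (K \ V) isOpen_compl_singleton (hK.diff hV)
      (fun y hy hyx => hy.2 (hxV hyx))
    -- `F` covers `K ∩ closure V` inside `U`, and `G` covers `K \ V` avoiding `x`. The union is some
    -- cover `c j`; as `e (s j)` contains `x`, the index `s j` must come from `F`.
    have hFG : F ∪ G ∈ {F : Finset ℕ | K ⊆ ⋃ i ∈ F, e i} := fun y hy => by
      by_cases hyV : y ∈ V
      · obtain ⟨i, hi, hyi⟩ := mem_iUnion₂.1 (hF ⟨hy, subset_closure hyV⟩)
        exact mem_iUnion₂.2 ⟨i, Finset.mem_union_left _ hi, hyi⟩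
      · obtain ⟨i, hi, hyi⟩ := mem_iUnion₂.1 (hG ⟨hy, hyV⟩)
        exact mem_iUnion₂.2 ⟨i, Finset.mem_union_right _ hi, hyi⟩
    rw [hc] at hFG
    obtain ⟨j, hj⟩ := hFG
    refine ⟨j, ?_⟩
    have hsj := hs j
    rw [hj, Finset.mem_union] at hsj
    rcases hsj with h | h
    · exact hFU _ h
    · exact absurd rfl (hGx _ h (hxs j))
  have hclosed : IsClosed {z : X × (ℕ → ℕ) | ∀ i, z.1 ∈ e (z.2 i)} := by
    rw [ofPred_forall]
    refine isClosed_iInter fun i => ?_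
    rw [← isOpen_compl_iff]
    have : {z : X × (ℕ → ℕ) | z.1 ∈ e (z.2 i)}ᶜ =
        ⋃ n, {z | z.1 ∈ (e n)ᶜ} ∩ {z | z.2 i ∈ ({n} : Set ℕ)} := by
      ext z
      simp
    rw [this]
    exact isOpen_iUnion fun n => ((hec n).isOpen_compl.preimage continuous_fst).inter
      ((isOpen_discrete {n}).preimage ((continuous_apply i).comp continuous_snd))
  have hcomp : IsCompact (Prod.snd '' ((K ×ˢ (univ.pi fun i => (c i : Set ℕ))) ∩
      {z : X × (ℕ → ℕ) | ∀ i, z.1 ∈ e (z.2 i)})) :=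
    ((hK.prod (isCompact_univ_pi fun i => (c i).finite_toSet.isCompact)).inter_right
      hclosed).image continuous_snd
  refine ⟨Subtype.val ⁻¹' (Prod.snd '' ((K ×ˢ (univ.pi fun i => (c i : Set ℕ))) ∩
      {z : X × (ℕ → ℕ) | ∀ i, z.1 ∈ e (z.2 i)})), ?_, ?_⟩
  · refine Subtype.isCompact_iff.2 ?_
    rw [Subtype.image_preimage_coe, inter_eq_right.2]
    · exact hcomp
    · rintro _ ⟨⟨x, s⟩, ⟨⟨hx, hs⟩, hxs⟩, rfl⟩
      exact ⟨x, hR s x hx (fun i => hs i trivial) hxs⟩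
  · ext x
    constructor
    · rintro ⟨s, ⟨⟨y, t⟩, ⟨⟨hy, -⟩, hys⟩, hts⟩, rfl⟩
      have hts : t = s.1 := hts
      subst hts
      have : y = q s := huniq _ _ _ (hq s) hys
      exact (congrArg (· ∈ K) this).mp hy
    · intro hx
      choose s hs hxs using fun j => by simpa only [mem_iUnion₂, exists_prop] using hcK j hx
      have hsR := hR s x hx hs hxs
      exact ⟨⟨s, x, hsR⟩, ⟨(x, s), ⟨⟨hx, fun i _ => hs i⟩, hxs⟩, rfl⟩,
        (huniq s _ x (hq ⟨s, x, hsR⟩) hxs).symm⟩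

end KNetwork

/-! ### Embeddings and Lindelöf property of function spaces -/

section FunctionSpace

/-- Function spaces between second countable spaces are hereditarily Lindelöf. -/
theorem isLindelof_continuousMap {M : Type*} {Y : Type*} [TopologicalSpace M] [TopologicalSpace Y]
    [SecondCountableTopology M] [SecondCountableTopology Y] (A : Set C(M, Y)) :
    IsLindelof A := by
  -- Replacing compact sets by basic open sets gives a countable subbase of a finer topology, and
  -- the Lindelöf property passes to coarser ones.
  let g : Set (Set C(M, Y)) :=
    image2 (fun U V => {f : C(M, Y) | MapsTo f U V}) (countableBasis M) (countableBasis Y)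
  have hle : generateFrom g ≤ ContinuousMap.compactOpen := by
    refine le_generateFrom ?_
    rintro _ ⟨K, hK, W, hW, rfl⟩
    let _ : TopologicalSpace C(M, Y) := generateFrom g
    refine isOpen_iff_mem_nhds.2 fun f hf => ?_
    have hx : ∀ x ∈ K, ∃ U ∈ countableBasis M, ∃ V ∈ countableBasis Y,
        x ∈ U ∧ V ⊆ W ∧ MapsTo f U V := by
      intro x hxK
      obtain ⟨V, hV, hfV, hVW⟩ :=
        (isBasis_countableBasis Y).exists_subset_of_mem_open (hf hxK) hW
      obtain ⟨U, hU, hxU, hUV⟩ := (isBasis_countableBasis M).exists_subset_of_mem_open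
        (show x ∈ f ⁻¹' V from hfV)
        (((isBasis_countableBasis Y).isOpen hV).preimage f.continuous)
      exact ⟨U, hU, V, hV, hxU, hVW, hUV⟩
    choose! U hU V hV hxU hVW hUV using hx
    obtain ⟨t, htK, hKt⟩ := hK.elim_nhds_subcover U fun x hxK =>
      ((isBasis_countableBasis M).isOpen (hU x hxK)).mem_nhds (hxU x hxK)
    have hmem : (⋂ x ∈ t, {f : C(M, Y) | MapsTo f (U x) (V x)}) ∈ 𝓝 f :=
      (Filter.biInter_finset_mem t).2 fun x hxt =>
        IsOpen.mem_nhds (isOpen_generateFrom_of_mem (g := g)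
          ⟨U x, hU x (htK x hxt), V x, hV x (htK x hxt), rfl⟩) (hUV x (htK x hxt))
    refine Filter.mem_of_superset hmem fun f' hf' y hy => ?_
    obtain ⟨x, hxt, hyx⟩ := mem_iUnion₂.1 (hKt hy)
    exact hVW x (htK x hxt) (mem_iInter₂.1 hf' x hxt hyx)
  have hsc : @SecondCountableTopology _ (generateFrom g) :=
    @SecondCountableTopology.mk _ (generateFrom g) ⟨g, (countable_countableBasis M).image2
      (countable_countableBasis Y) _, rfl⟩
  have hA : @IsLindelof _ (generateFrom g) A :=
    @HereditarilyLindelofSpace.isLindelof _ (generateFrom g) inferInstance A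
  have := @IsLindelof.image _ _ (generateFrom g) _ A id hA (continuous_id_iff_le.2 hle)
  simpa using this

variable {X : Type*} {Y : Type*} {Z : Type*} [TopologicalSpace X] [TopologicalSpace Y]
  [TopologicalSpace Z]

/-- Composition with a compact-covering map is an embedding of function spaces. -/
theorem isEmbedding_comp_of_compactCovering (p : C(Z, X))
    (hp : ∀ K : Set X, IsCompact K → ∃ L : Set Z, IsCompact L ∧ p '' L = K) :
    IsEmbedding fun f : C(X, Y) => f.comp p := by
  refine ⟨⟨le_antisymm (ContinuousMap.continuous_precomp p).le_induced ?_⟩, fun f g hfg => ?_⟩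
  · refine le_generateFrom ?_
    rintro _ ⟨K, hK, U, hU, rfl⟩
    obtain ⟨L, hL, rfl⟩ := hp K hK
    refine ⟨{f | MapsTo f L U}, ContinuousMap.isOpen_setOfPred_mapsTo hL hU, ?_⟩
    ext f
    exact (mapsTo_image_iff (f := f) (g := p) (s := L) (t := U)).symm
  · ext x
    obtain ⟨L, -, hL⟩ := hp {x} isCompact_singleton
    obtain ⟨z, -, rfl⟩ : x ∈ p '' L := hL ▸ rfl
    exact DFunLike.congr_fun hfg z

/-- The evaluation map of `X` into its double function space. -/
def doubleDual (Y : Type*) [TopologicalSpace Y] (x : X) : C(C(X, Y), Y) :=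
  ⟨fun f => f x, continuous_eval_const x⟩

/-- For compact `K`, even continuity and the tube lemma give one neighbourhood of `x` on which all
`f ∈ K` stay in the given open set. Conversely, `hsep` recovers open sets of `X` from point
evaluations at single `f`. -/
theorem isEmbedding_doubleDual {X : Type u} {Y : Type v} [TopologicalSpace X] [TopologicalSpace Y]
    [T0Space X] (hA : IsAscoliFor X Y)
    (hsep : ∀ (x : X) (U : Set X), IsOpen U → x ∈ U →
      ∃ (f : C(X, Y)) (V : Set Y), IsOpen V ∧ f x ∈ V ∧ f ⁻¹' V ⊆ U) :
    IsEmbedding (doubleDual Y : X → C(C(X, Y), Y)) := by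
  refine IsInducing.isEmbedding ⟨le_antisymm (Continuous.le_induced ?_) fun U hU => ?_⟩
  · refine continuous_generateFrom_iff.2 ?_
    rintro _ ⟨K, hK, U, hU, rfl⟩
    have hev := hU.preimage (hA K hK)
    have : CompactSpace K := isCompact_iff_compactSpace.1 hK
    refine isOpen_iff_mem_nhds.2 fun x hx => ?_
    obtain ⟨A, B, -, hB, hKA, hxB, hAB⟩ := generalized_tube_lemma (isCompact_univ (X := K))
      (isCompact_singleton (x := x)) hev (fun z hz => by
        obtain ⟨f, y⟩ := z
        obtain rfl : y = x := hz.2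
        exact hx f.2)
    refine Filter.mem_of_superset (hB.mem_nhds (hxB rfl)) fun y hy f hf => ?_
    exact hAB (show ((⟨f, hf⟩ : K), y) ∈ A ×ˢ B from ⟨hKA trivial, hy⟩)
  · refine ⟨⋃ (f : C(X, Y)) (V : {V : Set Y // IsOpen V ∧ f ⁻¹' V ⊆ U}),
      {F : C(C(X, Y), Y) | F f ∈ V.1}, isOpen_iUnion fun f => isOpen_iUnion fun V =>
        V.2.1.preimage (continuous_eval_const f), ?_⟩
    ext x
    simp only [preimage_iUnion, mem_iUnion]
    constructor
    · rintro ⟨f, V, hx⟩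
      exact V.2.2 hx
    · intro hx
      obtain ⟨f, V, hV, hfx, hVU⟩ := hsep x U hU hx
      exact ⟨f, ⟨V, hV, hVU⟩, hfx⟩

/-- Postcomposition with `e` keeps `K` compact, and continuity of evaluation can be tested after
`e`. This passes from `ℝ` to the interval, and from `Bool` to its lift. -/
theorem IsAscoliFor.of_isEmbedding {X : Type u} {Y : Type*} {Z : Type*} [TopologicalSpace X]
    [TopologicalSpace Y] [TopologicalSpace Z] (hA : IsAscoliFor X Z) {e : Y → Z}
    (he : IsEmbedding e) : IsAscoliFor X Y := by
  intro K hK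
  let E : C(X, Y) → C(X, Z) := fun f => ContinuousMap.comp ⟨e, he.continuous⟩ f
  have hE : Continuous E := ContinuousMap.continuous_postcomp _
  refine he.continuous_iff.2 ?_
  have h := hA (E '' K) (hK.image hE)
  exact h.comp (g := fun p : (E '' K) × X => (p.1 : C(X, Z)) p.2)
    (f := fun p : K × X => ((⟨E p.1, mem_image_of_mem E p.1.2⟩ : E '' K), p.2))
    (((hE.comp (continuous_subtype_val.comp continuous_fst)).subtype_mk _).prodMk continuous_snd)

end FunctionSpace

/-! ### Membership in stable classes -/

section Stable

variable {Q : SpaceClass.{u}}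

theorem IsStable.of_isEmbedding (hQ : IsStable Q) {X Y : Type u} [TopologicalSpace X]
    [TopologicalSpace Y] (hY : TopCat.of Y ∈ Q) {f : X → Y} (hf : IsEmbedding f) :
    TopCat.of X ∈ Q :=
  hQ.homeo _ (hQ.subspace _ hY (range f)) _ ⟨hf.toHomeomorph.symm⟩

theorem IsStable.punit_mem (hQ : IsStable Q) : TopCat.of PUnit.{u + 1} ∈ Q := by
  have h := hQ.prod Empty (fun i => i.elim) (fun i => i.elim)
  exact hQ.homeo _ h _ ⟨Homeomorph.homeomorphOfUnique _ _⟩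

theorem IsStable.discrete_mem (hQ : IsStable Q) (ι : Type) [Countable ι] [TopologicalSpace ι]
    [DiscreteTopology ι] : TopCat.of (ULift.{u} ι) ∈ Q := by
  have h := hQ.sum ι (fun _ => TopCat.of PUnit.{u + 1}) (fun _ => hQ.punit_mem)
  have : DiscreteTopology (ULift.{u} ι) := Homeomorph.ulift.isEmbedding.discreteTopology
  refine hQ.of_isEmbedding (Y := Σ _ : ι, PUnit.{u + 1}) h (f := fun i => ⟨i.down, PUnit.unit⟩) ?_
  exact (IsOpenEmbedding.of_continuous_injective_isOpenMap continuous_of_discreteTopology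
    (fun i j h => ULift.down_injective (congrArg Sigma.fst h))
    fun _ _ => isOpen_discrete _).isEmbedding

theorem IsStable.baire_subspace_mem (hQ : IsStable Q) (S : Set (ℕ → ℕ)) :
    TopCat.of (ULift.{u} S) ∈ Q := by
  have h := hQ.prod ℕ (fun _ => TopCat.of (ULift.{u} ℕ)) (fun _ => hQ.discrete_mem ℕ)
  refine hQ.of_isEmbedding (Y := ℕ → ULift.{u} ℕ) h (f := fun s i => ULift.up (s.down.1 i)) ?_
  exact (Homeomorph.piCongrRight fun _ : ℕ => (Homeomorph.ulift.{u} (X := ℕ)).symm).isEmbedding.comp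
    (IsEmbedding.subtypeVal.comp Homeomorph.ulift.isEmbedding)

/-- An `ℵ₀`-space that is Ascoli for a second countable `Y` separating points from closed sets
belongs to every `C_k`-stable class containing `Y`. -/
theorem IsCkStable.mem_of_isAscoliFor (hQ : IsCkStable Q) {X Y : Type u} [TopologicalSpace X]
    [TopologicalSpace Y] [SecondCountableTopology Y] (hY : TopCat.of Y ∈ Q)
    (hX : IsAlephZeroSpace X) (hA : IsAscoliFor X Y)
    (hsep : ∀ (x : X) (U : Set X), IsOpen U → x ∈ U →
      ∃ (f : C(X, Y)) (V : Set Y), IsOpen V ∧ f x ∈ V ∧ f ⁻¹' V ⊆ U) :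
    TopCat.of X ∈ Q := by
  obtain ⟨S, p, hp⟩ := hX.exists_compactCovering
  have := hX.1
  let d : C(ULift.{u} S, S) := ⟨ULift.down, Homeomorph.ulift.continuous⟩
  have hd : ∀ K : Set X, IsCompact K → ∃ L : Set (ULift.{u} S),
      IsCompact L ∧ (p.comp d) '' L = K := by
    intro K hK
    obtain ⟨L, hL, rfl⟩ := hp K hK
    refine ⟨ULift.up '' L, hL.image Homeomorph.ulift.symm.continuous, ?_⟩
    rw [image_image]
    rfl
  have : SecondCountableTopology (ULift.{u} S) :=
    Homeomorph.ulift.{u}.isEmbedding.secondCountableTopology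
  have hemb := isEmbedding_comp_of_compactCovering (Y := Y) (p.comp d) hd
  have hCX : TopCat.of C(X, Y) ∈ Q :=
    hQ.of_isEmbedding (hQ.funSpace _ (hQ.baire_subspace_mem S) (inferInstanceAs
      (LindelofSpace (ULift.{u} S))) _ hY) hemb
  -- Needed to apply `funSpace` a second time, now with `C(X, Y)` as the domain.
  have hL : LindelofSpace C(X, Y) :=
    ⟨hemb.isInducing.isLindelof_iff.2 (isLindelof_continuousMap _)⟩
  exact hQ.of_isEmbedding (hQ.funSpace _ hCX hL _ hY) (isEmbedding_doubleDual hA hsep)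

theorem IsCkStable.mem_of_isTwoAscoli (hQ : IsCkStable Q) {X : Type u} [TopologicalSpace X]
    (hX : IsAlephZeroSpace X) (hz : IsZeroDimensional X) (hA : IsTwoAscoli X) :
    TopCat.of X ∈ Q := by
  have : DiscreteTopology (ULift.{u} Bool) := Homeomorph.ulift.isEmbedding.discreteTopology
  refine hQ.mem_of_isAscoliFor (hQ.discrete_mem Bool) hX
    (IsAscoliFor.of_isEmbedding hA Homeomorph.ulift.isEmbedding) fun x U hU hxU => ?_
  obtain ⟨C, hC, hxC, hCU⟩ := hz.exists_subset_of_mem_open hxU hU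
  have hC : IsClopen C := hC
  refine ⟨⟨fun y => ULift.up (C.boolIndicator y), Homeomorph.ulift.symm.continuous.comp
    ((continuous_boolIndicator_iff_isClopen C).2 hC)⟩, {ULift.up true}, isOpen_discrete _, ?_, ?_⟩
  · exact congrArg ULift.up ((mem_iff_boolIndicator C x).1 hxC)
  · intro y hy
    exact hCU ((mem_iff_boolIndicator C y).2 (congrArg ULift.down hy))

theorem IsAlephZeroSpace.lindelofSpace {X : Type u} [TopologicalSpace X]
    (hX : IsAlephZeroSpace X) : LindelofSpace X := by
  obtain ⟨S, p, hp⟩ := hX.exists_compactCovering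
  refine ⟨?_⟩
  have hs : Function.Surjective p := fun x => by
    obtain ⟨L, -, hL⟩ := hp {x} isCompact_singleton
    obtain ⟨z, -, hz⟩ : x ∈ p '' L := hL ▸ rfl
    exact ⟨z, hz⟩
  rw [← hs.range_eq]
  exact isLindelof_range p.continuous

theorem IsCkStable.mem_of_isAscoli (hQ : IsCkStable Q) {X I : Type u} [TopologicalSpace X]
    [TopologicalSpace I] (hI : TopCat.of I ∈ Q) (φ : I ≃ₜ unitInterval)
    (hX : IsAlephZeroSpace X) (hA : IsAscoli X) : TopCat.of X ∈ Q := by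
  have := hX.1
  -- Regular Lindelöf spaces are normal, which yields the complete regularity used below.
  have := hX.lindelofSpace
  have : SecondCountableTopology I := φ.isEmbedding.secondCountableTopology
  refine hQ.mem_of_isAscoliFor hI hX (IsAscoliFor.of_isEmbedding hA
    (IsEmbedding.subtypeVal.comp φ.isEmbedding)) fun x U hU hxU => ?_
  obtain ⟨f, hf, hfx, hfU⟩ := CompletelyRegularSpace.completely_regular x Uᶜ hU.isClosed_compl
    (fun h => h hxU)
  refine ⟨⟨fun y => φ.symm (f y), φ.symm.continuous.comp hf⟩, φ ⁻¹' {1}ᶜ,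
    isOpen_compl_singleton.preimage φ.continuous, ?_, fun y hy => ?_⟩
  · simp [hfx]
  · by_contra hyU
    exact hy (by simpa using hfU hyU)

end Stable

end AscoliCk

theorem theoremt :
    (∀ 𝒳 : AscoliCk.SpaceClass.{u}, 𝒳.Nonempty →
      (∀ X : TopCat.{u}, AscoliCk.IsZeroDimensional X → AscoliCk.IsTwoAscoli X →
        AscoliCk.IsAlephZeroSpace X → X ∈ AscoliCk.ckClosure 𝒳) ∧
      ((∃ I ∈ 𝒳, Nonempty (I ≃ₜ unitInterval)) →
        ∀ X : TopCat.{u}, AscoliCk.IsAscoli X → AscoliCk.IsAlephZeroSpace X →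
          X ∈ AscoliCk.ckClosure 𝒳)) ∧
    (∀ X : TopCat.{u}, AscoliCk.IsAscoli X → AscoliCk.IsAlephZeroSpace X →
      X ∈ AscoliCk.ckClosure AscoliCk.separableMetrizable) := by
  have key : ∀ 𝒳 : AscoliCk.SpaceClass.{u}, (∃ I ∈ 𝒳, Nonempty (I ≃ₜ unitInterval)) →
      ∀ X : TopCat.{u}, AscoliCk.IsAscoli X → AscoliCk.IsAlephZeroSpace X →
        X ∈ AscoliCk.ckClosure 𝒳 := by
    rintro 𝒳 ⟨I, hI, ⟨φ⟩⟩ X hA hX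
    have h := (AscoliCk.isLeast_ckClosure 𝒳).1
    exact h.1.mem_of_isAscoli (h.2 hI) φ hX hA
  refine ⟨fun 𝒳 _ => ⟨fun X hz hA hX => ?_, key 𝒳⟩, key _ ⟨TopCat.of (ULift.{u} unitInterval),
    ⟨Homeomorph.ulift.isEmbedding.metrizableSpace, ?_⟩, ⟨Homeomorph.ulift⟩⟩⟩
  · exact (AscoliCk.isLeast_ckClosure 𝒳).1.1.mem_of_isTwoAscoli hX hz hA
  · have : SecondCountableTopology (ULift.{u} unitInterval) :=
      Homeomorph.ulift.{u}.isEmbedding.secondCountableTopology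
    exact inferInstanceAs (SeparableSpace (ULift.{u} unitInterval))
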